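/- Write $[N]=\{1,\dots,N\}$. Let $(w(n))_{n\ge1}$ be a sequence of real numbers in $(0,1]$ whose partial sums $G(n)=\sum_{i\in[n]}w(i)$ tend to infinity. Let $(a_n)_{n\ge1}$ be a sequence of integers such that, for some $\eta>0$, $$\frac{a_{n+1}}{a_n}\ \ge\ 1+\frac{1}{(\log\log G(n))^{1-\eta}}\qquad\text{for all sufficiently large } n .$$ Then $(a_n)$ is strong sweeping out for the $w$-weighted averages. That is: let $T$ be an aperiodic measure preserving transformation of a probability space $(X,\Sigma,\mu)$, and assume that all $a_n$ are non-negative or that $T$ is invertible (with measurable inverse), so that the powers $T^{a_n}$ make sense. Then for every $\epsilon>0$ there is a set $E\in\Sigma$ with $\mu(E)<\epsilon$ such that for almost every $x\in X$ $$\limsup_{N\to\infty}\frac1{G(N)}\sum_{n\in[N]}w(n)\mathbf 1_E(T^{a_n}x)=1\quad\text{and}\quad \liminf_{N\to\infty}\frac1{G(N)}\sum_{n\in[N]}w(n)\mathbf 1_E(T^{a_n}x)=0 .$$ Here $T$ is called aperiodic if for every $k\ge1$ and every $A\in\Sigma$ with $\mu(A)>0$ there is a set $B\in\Sigma$, $B\subseteq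 A$, with $\mu(B\,\triangle\,T^{-k}B)>0$; if countably many sets of $\Sigma$ separate the points of $X$ (for example if $X$ is a standard Borel or Lebesgue space), this means that $\mu\{x: T^kx=x\}=0$ for every $k\ge1$. -/

import Mathlib

open MeasureTheory Filter Topology

universe u

namespace WeightedSweeping

/-- A measure preserving transformation `T` of a probability space is aperiodic if for no `k ≥ 1`
there is a set `A` of positive measure on which `T^k` acts trivially, that is, such that `T^k`
fixes, modulo null sets, every measurable subset of `A`. No assumption on the probability space is
needed for this notion; `aperiodic_iff` below shows that, as soon as countably many measurable sets
separate the points (in particular for all standard Borel spaces and their completions), it says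
that almost no point is periodic. -/
def Aperiodic {X : Type*} [MeasurableSpace X] (μ : Measure X) (T : X → X) : Prop :=
  ∀ k : ℕ, 1 ≤ k → ∀ A : Set X, MeasurableSet A → 0 < μ A →
    ∃ B ⊆ A, MeasurableSet B ∧ 0 < μ (symmDiff B (T^[k] ⁻¹' B))

theorem aperiodic_iff {X : Type*} [MeasurableSpace X] [MeasurableSpace.CountablySeparated X]
    {μ : Measure X} [IsProbabilityMeasure μ] {T : X → X} (hT : MeasurePreserving T μ μ) :
    Aperiodic μ T ↔ ∀ k : ℕ, 1 ≤ k → ∀ᵐ x ∂μ, T^[k] x ≠ x := by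
  have hTk : ∀ k, MeasurePreserving T^[k] μ μ := fun k => hT.iterate k
  constructor
  · intro h k hk
    by_contra hne
    obtain ⟨f, hf, hfinj⟩ :=
      MeasurableSpace.measurable_injection_nat_bool_of_countablySeparated X
    have hmeas : MeasurableSet {x | T^[k] x = x} := by
      have h1 : MeasurableSet {x | f (T^[k] x) = f x} :=
        measurableSet_eq_fun (hf.comp (hTk k).measurable) hf
      simpa only [hfinj.eq_iff] using h1
    have hpos : 0 < μ {x | T^[k] x = x} := by
      rw [pos_iff_ne_zero]
      intro h0
      apply hne
      rw [ae_iff]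
      simpa using h0
    obtain ⟨B, hBA, hB, hBpos⟩ := h k hk _ hmeas hpos
    have hsub : B ⊆ T^[k] ⁻¹' B := by
      intro x hx
      have hx' : T^[k] x = x := hBA hx
      simpa [hx'] using hx
    have hae : B =ᵐ[μ] T^[k] ⁻¹' B :=
      ae_eq_of_subset_of_measure_ge hsub
        ((hTk k).measure_preimage hB.nullMeasurableSet).le hB.nullMeasurableSet
        (measure_ne_top _ _)
    exact hBpos.ne' (measure_symmDiff_eq_zero_iff.2 hae)
  · intro h k hk A hA hApos
    obtain ⟨S, hSc, hSm, hSsep⟩ :=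
      (MeasurableSpace.CountablySeparated.countably_separated :
        HasCountableSeparatingOn X MeasurableSet Set.univ).exists_countable_separating
    by_contra hno
    push Not at hno
    -- Sets whose preimage they are disjoint from must be null.
    have key : ∀ B ⊆ A, MeasurableSet B → (∀ x ∈ B, T^[k] x ∉ B) → μ B = 0 := by
      intro B hBA hB hdis
      have h0 := hno B hBA hB
      refine le_antisymm (le_trans (measure_mono ?_) h0) (zero_le)
      intro x hx
      exact Or.inl ⟨hx, hdis x hx⟩
    have hnull : μ (⋃ s ∈ S, (A ∩ (s \ T^[k] ⁻¹' s) ∪ A ∩ (T^[k] ⁻¹' s \ s))) = 0 := by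
      rw [measure_biUnion_null_iff hSc]
      intro s hs
      have hs' := hSm s hs
      have hps := (hTk k).measurable hs'
      rw [measure_union_null_iff]
      refine ⟨key _ Set.inter_subset_left (hA.inter (hs'.diff hps)) ?_,
        key _ Set.inter_subset_left (hA.inter (hps.diff hs')) ?_⟩
      · rintro x ⟨-, -, hx⟩ ⟨-, hx', -⟩
        exact hx hx'
      · rintro x ⟨-, hx, -⟩ ⟨-, -, hx'⟩
        exact hx' hx
    have hfix : μ {x | ¬ T^[k] x ≠ x} = 0 := ae_iff.1 (h k hk)
    refine hApos.ne' (measure_mono_null ?_ (measure_union_null hnull hfix))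
    intro x hx
    by_cases hxx : T^[k] x = x
    · exact Or.inr (by simpa using hxx)
    · left
      by_contra hcon
      apply hxx
      refine hSsep _ (Set.mem_univ _) _ (Set.mem_univ _) ?_
      intro s hs
      simp only [Set.mem_iUnion, not_exists] at hcon
      have := hcon s hs
      simp only [Set.mem_union, Set.mem_inter_iff, Set.mem_sdiff, Set.mem_preimage] at this
      tauto

/-- The partial sums `G(n) = ∑_{i ∈ [n]} w(i)`, where `[n] = {1, …, n}`. -/
noncomputable def partialSum (w : ℕ → ℝ) (n : ℕ) : ℝ := ∑ i ∈ Finset.Icc 1 n, w i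

/-- The weighted average `(∑_{n ∈ [N]} w(n))⁻¹ ∑_{n ∈ [N]} w(n) f(n)`. -/
noncomputable def weightedAverage (w f : ℕ → ℝ) (N : ℕ) : ℝ :=
  (∑ n ∈ Finset.Icc 1 N, w n * f n) / partialSum w N

/-- For every `ε > 0` there is a measurable set `E` with `μ(E) < ε` such that, at almost every `x`,
the `w`-weighted averages over `n ∈ [N]` of `1_E (S n x)` have upper limit `1` and lower
limit `0` as `N → ∞`. -/
def SweepsOut {X : Type*} [MeasurableSpace X] (μ : Measure X) (w : ℕ → ℝ) (S : ℕ → X → X) :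
    Prop :=
  ∀ ε : ℝ, 0 < ε → ∃ E : Set X, MeasurableSet E ∧ μ.real E < ε ∧ ∀ᵐ x ∂μ,
    limsup (fun N => weightedAverage w (fun n => E.indicator (fun _ => (1 : ℝ)) (S n x)) N)
      atTop = 1 ∧
    liminf (fun N => weightedAverage w (fun n => E.indicator (fun _ => (1 : ℝ)) (S n x)) N)
      atTop = 0

/-- The sequence of integers `a 1, a 2, …` is strong sweeping out for the `w`-weighted averages:
in every aperiodic system in which the powers `T ^ (a n)` make sense, the averages along
`T ^ (a n)` sweep out. The powers make sense if no `a n` is negative, for any `T`, and also if `T`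
is invertible, for any `a`. -/
def StrongSweepingOut (w : ℕ → ℝ) (a : ℕ → ℤ) : Prop :=
  ∀ (X : Type u) [MeasurableSpace X] (μ : Measure X) [IsProbabilityMeasure μ],
    ((∀ n, 1 ≤ n → 0 ≤ a n) → ∀ T : X → X, MeasurePreserving T μ μ → Aperiodic μ T →
      SweepsOut μ w (fun n => T^[(a n).toNat])) ∧
    (∀ T : X ≃ᵐ X, MeasurePreserving T μ μ → Aperiodic μ T →
      SweepsOut μ w (fun n x => ((T.toEquiv : Equiv.Perm X) ^ a n) x))

end WeightedSweeping

/-! The core is a finite-window statement, `exists_absorbing_set`: for every `δ`, most orbits, over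
some initial range `[N]`, spend all but a fraction `δ` of the weight in one set `H` of measure at
most `δ`. `Aperiodic.exists_height` gives an integer height `h` with `h (T^m x) = h x - m` off a
small set, so an angle `θ` turns the orbit into a rotation. Cut the circle into `Q` arcs and sort
the times into `K` residue classes, `2K ≤ δQ`. If the sequence grows by `2Q` along each class,
nested intervals (`exists_rotation`) give angles `θ j` whose rotations follow prescribed arcs. Give
each of the `Q ^ K` patterns of arcs its own block of times, carrying most of the weight so far.
Whatever the arcs of `h x * θ j`, some block moves the orbit of `x` into two adjacent arcs
throughout; averaging over the `Q` positions makes this target small.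

The `Q ^ K` blocks multiply `G` by about `R ^ (Q ^ K)`. With `log (log G) ≤ L`, a `K` between `L ^
(1 - η)` and `L` gives growth `2Q` along classes while keeping `Q ^ K` below `exp L`; hence the
iterated logarithm.

In `sweepsOut_of_absorbing_sets`, successive windows with rapidly shrinking `H k` are glued: even `H
k` are put into `E`, odd ones are cut out, and Borel–Cantelli keeps later sets from disturbing
earlier windows. Negative exponents reduce to the inverse map. -/

namespace WeightedSweeping

/-! ### Aperiodicity and approximate Rokhlin towers -/

section Towers

variable {X : Type*} [MeasurableSpace X] {μ : Measure X} {T : X → X}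

/-- The set `B \ T^{-k}B` works: were it null, `B` would lie in a set of the same finite measure and
so equal it almost everywhere. -/
theorem Aperiodic.exists_subset_disjoint_preimage [IsFiniteMeasure μ] (hap : Aperiodic μ T)
    (hT : MeasurePreserving T μ μ) {k : ℕ} (hk : 1 ≤ k) {A : Set X} (hA : MeasurableSet A)
    (hpos : 0 < μ A) :
    ∃ C ⊆ A, MeasurableSet C ∧ 0 < μ C ∧ Disjoint C (T^[k] ⁻¹' C) := by
  obtain ⟨B, hBA, hB, hBpos⟩ := hap k hk A hA hpos
  have hTk := hT.iterate k
  have hpB := hTk.measurable hB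
  refine ⟨B \ T^[k] ⁻¹' B, Set.sdiff_subset.trans hBA, hB.diff hpB, ?_, ?_⟩
  · rw [pos_iff_ne_zero]
    intro h0
    have hle : B ≤ᵐ[μ] T^[k] ⁻¹' B := ae_le_set.2 h0
    have hae : B =ᵐ[μ] T^[k] ⁻¹' B :=
      ae_eq_of_ae_subset_of_measure_ge hle
        (hTk.measure_preimage hB.nullMeasurableSet).le hB.nullMeasurableSet (measure_ne_top _ _)
    exact hBpos.ne' (measure_symmDiff_eq_zero_iff.2 hae)
  · rw [Set.disjoint_left]
    rintro x ⟨-, hx⟩ ⟨hx', -⟩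
    exact hx hx'

theorem Aperiodic.exists_subset_disjoint_preimages [IsFiniteMeasure μ] (hap : Aperiodic μ T)
    (hT : MeasurePreserving T μ μ) (n : ℕ) {A : Set X} (hA : MeasurableSet A) (hpos : 0 < μ A) :
    ∃ C ⊆ A, MeasurableSet C ∧ 0 < μ C ∧
      ∀ k, 1 ≤ k → k ≤ n → Disjoint C (T^[k] ⁻¹' C) := by
  induction n with
  | zero => exact ⟨A, subset_rfl, hA, hpos, fun k h1 h2 => absurd h2 (by omega)⟩
  | succ n ih =>
    obtain ⟨C, hCA, hC, hCpos, hdis⟩ := ih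
    obtain ⟨D, hDC, hD, hDpos, hdis'⟩ :=
      hap.exists_subset_disjoint_preimage hT (Nat.le_add_left 1 n) hC hCpos
    refine ⟨D, hDC.trans hCA, hD, hDpos, fun k h1 h2 => ?_⟩
    rcases Nat.lt_or_ge n k with h | h
    · obtain rfl : k = n + 1 := by omega
      exact hdis'
    · exact (hdis k h1 h).mono hDC (Set.preimage_mono hDC)

/-- Exhaustion: if every set of positive measure contains a set of positive measure with
property `P`, then countably many sets with property `P` cover almost everything. -/
theorem exists_seq_iUnion_compl_null [IsFiniteMeasure μ] {P : Set X → Prop} (h0 : P ∅)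
    (h : ∀ A, MeasurableSet A → 0 < μ A → ∃ V ⊆ A, MeasurableSet V ∧ 0 < μ V ∧ P V) :
    ∃ V : ℕ → Set X, (∀ m, MeasurableSet (V m)) ∧ (∀ m, P (V m)) ∧ μ (⋃ m, V m)ᶜ = 0 := by
  set S : Set ENNReal :=
    {r | ∃ V : ℕ → Set X, (∀ m, MeasurableSet (V m)) ∧ (∀ m, P (V m)) ∧ μ (⋃ m, V m) = r} with hS
  have hne : S.Nonempty := ⟨_, fun _ => ∅, fun _ => .empty, fun _ => h0, rfl⟩
  obtain ⟨u, -, hu, huS⟩ := exists_seq_tendsto_sSup hne (OrderTop.bddAbove S)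
  choose W hWm hWP hWu using huS
  -- Merging a maximizing sequence of countable families attains the supremum; adding a further set
  -- of positive measure would exceed it.
  set V : ℕ → Set X := fun i => W i.unpair.1 i.unpair.2 with hV
  have hVm : ∀ i, MeasurableSet (V i) := fun i => hWm _ _
  have hVP : ∀ i, P (V i) := fun i => hWP _ _
  have hsub : ∀ k, (⋃ m, W k m) ⊆ ⋃ i, V i := by
    intro k x hx
    obtain ⟨m, hm⟩ := Set.mem_iUnion.1 hx
    exact Set.mem_iUnion.2 ⟨Nat.pair k m, by simpa [hV] using hm⟩
  have hsup : sSup S ≤ μ (⋃ i, V i) :=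
    le_of_tendsto' hu fun k => (hWu k) ▸ measure_mono (hsub k)
  refine ⟨V, hVm, hVP, ?_⟩
  by_contra hcon
  obtain ⟨D, hDV, hD, hDpos, hDP⟩ :=
    h _ (MeasurableSet.iUnion hVm).compl (pos_iff_ne_zero.2 hcon)
  set V' : ℕ → Set X := fun i => Nat.casesOn i D V with hV'
  have hU : (⋃ i, V' i) = D ∪ ⋃ i, V i := by
    ext x
    simp only [Set.mem_iUnion, Set.mem_union]
    constructor
    · rintro ⟨_ | i, hi⟩
      · exact Or.inl hi
      · exact Or.inr ⟨i, hi⟩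
    · rintro (hx | ⟨i, hi⟩)
      · exact ⟨0, hx⟩
      · exact ⟨i + 1, hi⟩
  have hmem : μ (⋃ i, V' i) ∈ S := by
    refine ⟨V', ?_, ?_, rfl⟩
    · rintro (_ | i)
      exacts [hD, hVm i]
    · rintro (_ | i)
      exacts [hDP, hVP i]
  have h1 := (le_sSup hmem).trans hsup
  rw [hU, measure_union (Set.subset_compl_iff_disjoint_right.1 hDV) (MeasurableSet.iUnion hVm)]
    at h1
  have h2 : μ (⋃ i, V i) < μ D + μ (⋃ i, V i) := by
    rw [add_comm]
    exact ENNReal.lt_add_right (measure_ne_top _ _) hDpos.ne'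
  exact absurd h1 (not_le.2 h2)

/-- The set of points whose orbit meets `V` is almost invariant. -/
theorem ae_orbit_meets_iff [IsFiniteMeasure μ] (hT : MeasurePreserving T μ μ) {V : Set X}
    (hV : MeasurableSet V) (k : ℕ) :
    ∀ᵐ x ∂μ, (∃ i, T^[i] x ∈ V) ↔ ∃ i, T^[i] (T^[k] x) ∈ V := by
  have hm : MeasurableSet {x | ∃ i, T^[i] x ∈ V} := by
    have : {x | ∃ i, T^[i] x ∈ V} = ⋃ i, T^[i] ⁻¹' V := by ext; simp
    rw [this]
    exact MeasurableSet.iUnion fun i => (hT.iterate i).measurable hV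
  have hsub : T^[k] ⁻¹' {x | ∃ i, T^[i] x ∈ V} ⊆ {x | ∃ i, T^[i] x ∈ V} := by
    rintro x ⟨i, hi⟩
    exact ⟨i + k, by rwa [Function.iterate_add_apply]⟩
  have hae := ae_eq_of_subset_of_measure_ge hsub
    ((hT.iterate k).measure_preimage hm.nullMeasurableSet).ge
    ((hT.iterate k).measurable hm).nullMeasurableSet (measure_ne_top _ _)
  filter_upwards [hae.mem_iff] with x hx
  exact hx.symm

/-- In an aperiodic system there are arbitrarily small sets that almost every orbit meets. -/
theorem Aperiodic.exists_small_sweeping [IsProbabilityMeasure μ] (hap : Aperiodic μ T)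
    (hT : MeasurePreserving T μ μ) (n : ℕ) :
    ∃ C, MeasurableSet C ∧ (n + 1 : ENNReal) * μ C ≤ 1 ∧ ∀ᵐ x ∂μ, ∃ i, T^[i] x ∈ C := by
  classical
  obtain ⟨V, hVm, hVdis, hV0⟩ := exists_seq_iUnion_compl_null (μ := μ)
    (P := fun C => ∀ k, 1 ≤ k → k ≤ n → Disjoint C (T^[k] ⁻¹' C)) (by simp)
    (fun A hA hpos => hap.exists_subset_disjoint_preimages hT n hA hpos)
  have hOm : ∀ m, MeasurableSet {x | ∃ i, T^[i] x ∈ V m} := fun m => by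
    have : {x | ∃ i, T^[i] x ∈ V m} = ⋃ i, T^[i] ⁻¹' V m := by ext; simp
    rw [this]
    exact MeasurableSet.iUnion fun i => (hT.iterate i).measurable (hVm m)
  -- Each point of `C` lies in the first `V m` its orbit meets. This index is almost surely constant
  -- along orbits, so returns to `C` are returns to a single `V m`.
  set C : Set X := ⋃ m, V m \ ⋃ l, ⋃ (_ : l < m), {x | ∃ i, T^[i] x ∈ V l} with hC
  have hmemC : ∀ x, x ∈ C ↔ ∃ m, x ∈ V m ∧ ∀ l < m, ¬ ∃ i, T^[i] x ∈ V l := by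
    intro x; simp [hC]
  have hCm : MeasurableSet C := MeasurableSet.iUnion fun m => (hVm m).diff
    (MeasurableSet.iUnion fun l => MeasurableSet.iUnion fun _ => hOm l)
  have hdis : ∀ k, 1 ≤ k → k ≤ n → μ (C ∩ T^[k] ⁻¹' C) = 0 := by
    intro k h1 h2
    rw [measure_eq_zero_iff_ae_notMem]
    filter_upwards [ae_all_iff.2 fun m => ae_orbit_meets_iff hT (hVm m) k] with x hx
    rintro ⟨hx1, hx2⟩
    obtain ⟨m, hm, hml⟩ := (hmemC x).1 hx1
    obtain ⟨m', hm', hml'⟩ := (hmemC _).1 hx2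
    have e1 : ¬ m < m' := fun hlt => hml' m hlt ((hx m).1 ⟨0, hm⟩)
    have e2 : ¬ m' < m := fun hlt => hml m' hlt ((hx m').2 ⟨0, hm'⟩)
    obtain rfl : m = m' := by omega
    exact Set.disjoint_left.1 (hVdis m k h1 h2) hm hm'
  refine ⟨C, hCm, ?_, ?_⟩
  · have hpair : Pairwise (Function.onFun (AEDisjoint μ)
        fun i : Fin (n + 1) => T^[(i : ℕ)] ⁻¹' C) := by
      have key : ∀ i j : Fin (n + 1), i < j →
          AEDisjoint μ (T^[(i : ℕ)] ⁻¹' C) (T^[(j : ℕ)] ⁻¹' C) := by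
        intro i j hij
        have hsplit : T^[(j : ℕ)] = T^[(j : ℕ) - i] ∘ T^[(i : ℕ)] := by
          rw [← Function.iterate_add]; congr 1; omega
        rw [AEDisjoint, hsplit, Set.preimage_comp, ← Set.preimage_inter,
          (hT.iterate _).measure_preimage (hCm.inter
            ((hT.iterate _).measurable hCm)).nullMeasurableSet]
        exact hdis _ (by omega) (by omega)
      intro i j hij
      rcases lt_or_gt_of_ne hij with h | h
      · exact key i j h
      · exact (key j i h).symm
    have hsum := measure_iUnion₀ hpair
      fun i => ((hT.iterate (i : ℕ)).measurable hCm).nullMeasurableSet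
    have hle : μ (⋃ i : Fin (n + 1), T^[(i : ℕ)] ⁻¹' C) ≤ 1 := prob_le_one
    rw [hsum, tsum_fintype] at hle
    simpa [(hT.iterate _).measure_preimage hCm.nullMeasurableSet] using hle
  · have hcov : ∀ᵐ x ∂μ, x ∈ ⋃ m, V m := by
      rw [ae_iff]; exact hV0
    filter_upwards [hcov] with x hx
    have hex : ∃ m, ∃ i, T^[i] x ∈ V m := by
      obtain ⟨m, hm⟩ := Set.mem_iUnion.1 hx
      exact ⟨m, 0, hm⟩
    obtain ⟨i, hi⟩ := Nat.find_spec hex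
    refine ⟨i, (hmemC _).2 ⟨_, hi, fun l hl => ?_⟩⟩
    rintro ⟨j, hj⟩
    exact Nat.find_min hex hl ⟨j + i, by rwa [Function.iterate_add_apply]⟩

/-- An approximate Rokhlin tower: a measurable integer height that decreases by `m` under `T^m`
for all `m ≤ B`, outside a small set. -/
theorem Aperiodic.exists_height [IsProbabilityMeasure μ] (hap : Aperiodic μ T)
    (hT : MeasurePreserving T μ μ) (B : ℕ) {δ : ℝ} (hδ : 0 < δ) :
    ∃ h : X → ℤ, Measurable h ∧
      μ {x | ¬ ∀ m ≤ B, h (T^[m] x) = h x - m} ≤ ENNReal.ofReal δ := by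
  classical
  obtain ⟨n, hn⟩ := exists_nat_gt ((B : ℝ) / δ)
  obtain ⟨C, hC, hCn, hhit⟩ := hap.exists_small_sweeping hT n
  -- The height is the hitting time of `C`; the second alternative gives the null set of points that
  -- never hit `C` the height `0`.
  have hp : ∀ x, ∃ i, T^[i] x ∈ C ∨ ∀ j, T^[j] x ∉ C := by
    intro x
    by_cases h : ∃ i, T^[i] x ∈ C
    · obtain ⟨i, hi⟩ := h
      exact ⟨i, Or.inl hi⟩
    · exact ⟨0, Or.inr (by simpa using h)⟩
  have hmeas : Measurable fun x => Nat.find (hp x) := by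
    refine measurable_find hp fun k => ?_
    have : {x | T^[k] x ∈ C ∨ ∀ j, T^[j] x ∉ C} = T^[k] ⁻¹' C ∪ ⋂ j, (T^[j] ⁻¹' C)ᶜ := by
      ext; simp
    rw [this]
    exact ((hT.iterate k).measurable hC).union
      (MeasurableSet.iInter fun j => ((hT.iterate j).measurable hC).compl)
  refine ⟨fun x => (Nat.find (hp x) : ℤ), by fun_prop, ?_⟩
  have hstep : ∀ x, (∃ i, T^[i] x ∈ C) → x ∉ C → Nat.find (hp x) = Nat.find (hp (T x)) + 1 := by
    intro x hx hxC
    rw [Nat.find_eq_iff]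
    obtain ⟨i, hi⟩ := hx
    obtain ⟨i, rfl⟩ : ∃ i', i = i' + 1 := by
      rcases i with _ | i
      · exact absurd hi hxC
      · exact ⟨i, rfl⟩
    constructor
    · rcases Nat.find_spec (hp (T x)) with h | h
      · exact Or.inl h
      · exact absurd hi (h i)
    · rintro (_ | l) hl
      · rintro (h | h)
        · exact hxC h
        · exact h (i + 1) hi
      · have := Nat.find_min (hp (T x)) (m := l) (by omega)
        rintro (h | h)
        · exact this (Or.inl h)
        · exact h (i + 1) hi
  have hbad : μ (⋃ i ∈ Finset.range B, T^[i] ⁻¹' C) ≤ ENNReal.ofReal δ := by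
    refine (measure_biUnion_finset_le _ _).trans ?_
    simp only [(hT.iterate _).measure_preimage hC.nullMeasurableSet, Finset.sum_const,
      Finset.card_range, nsmul_eq_mul]
    have hr : ((n : ℝ) + 1) * μ.real C ≤ 1 := by
      have := ENNReal.toReal_mono ENNReal.one_ne_top hCn
      rw [ENNReal.toReal_mul, ENNReal.toReal_one] at this
      convert this using 2
      · rw [ENNReal.toReal_add (by simp) (by simp)]; simp
      · rfl
    rw [← ofReal_measureReal, ← ENNReal.ofReal_natCast, ← ENNReal.ofReal_mul (by positivity)]
    apply ENNReal.ofReal_le_ofReal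
    rw [div_lt_iff₀ hδ] at hn
    have h0 : 0 ≤ μ.real C := measureReal_nonneg
    nlinarith
  refine le_trans ?_ hbad
  have hhit' : ∀ᵐ x ∂μ, ∀ m, ∃ i, T^[i] (T^[m] x) ∈ C :=
    ae_all_iff.2 fun m => (hT.iterate m).quasiMeasurePreserving.ae hhit
  refine measure_mono_ae ?_
  filter_upwards [hhit'] with x hx hbadx
  by_contra hgood
  refine hbadx fun m hm => ?_
  have hnot : ∀ i < B, T^[i] x ∉ C := fun i hi hiC =>
    hgood (Set.mem_iUnion₂.2 ⟨i, Finset.mem_range.2 hi, hiC⟩)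
  clear hbadx
  induction m with
  | zero => simp
  | succ m ih =>
    have h1 := ih (by omega)
    have h2 := hstep _ (hx m) (hnot m (by omega))
    simp only [Function.iterate_succ_apply'] at h1 ⊢
    push_cast
    omega
end Towers

/-! ### Prescribed rotations, blocks and parameters -/

section Combinatorics

/-- Nested intervals: along a finite sequence `β` growing by factors `≥ 2Q`, the fractional parts
of `β i * θ` can be prescribed up to `1 / Q`. -/
theorem exists_rotation (Q : ℕ) (hQ : 1 ≤ Q) (β : ℕ → ℝ) (u : ℕ → ℤ) (h0 : 0 < β 0) (I : ℕ)
    (hβ : ∀ i < I, 2 * Q * β i ≤ β (i + 1)) :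
    ∃ θ : ℝ, ∀ i ≤ I, ∃ z : ℤ, (u i + Q * z : ℝ) ≤ Q * (β i * θ) ∧
      Q * (β i * θ) ≤ u i + Q * z + 1 := by
  have hQ' : (1 : ℝ) ≤ Q := by exact_mod_cast hQ
  have hpos : ∀ i ≤ I, 0 < β i := by
    intro i
    induction i with
    | zero => exact fun _ => h0
    | succ i ih =>
      intro hi
      have := ih (by omega)
      have := hβ i (by omega)
      exact lt_of_lt_of_le (by positivity) this
  -- Induction needs a whole interval of `θ`, on which the last condition implies all earlier ones.
  suffices h : ∀ J ≤ I, ∃ v : ℤ, ∀ θ : ℝ, (u J + Q * v : ℝ) ≤ Q * (β J * θ) →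
      Q * (β J * θ) ≤ u J + Q * v + 1 → ∀ i ≤ J, ∃ z : ℤ, (u i + Q * z : ℝ) ≤ Q * (β i * θ) ∧
      Q * (β i * θ) ≤ u i + Q * z + 1 by
    obtain ⟨v, hv⟩ := h I le_rfl
    have hI := hpos I le_rfl
    have e : (Q : ℝ) * (β I * ((u I + Q * v) / (Q * β I))) = u I + Q * v := by
      field_simp
    exact ⟨(u I + Q * v) / (Q * β I), hv _ (by rw [e]) (by rw [e]; linarith)⟩
  intro J
  induction J with
  | zero =>
    refine fun _ => ⟨0, fun θ h1 h2 i hi => ⟨0, ?_⟩⟩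
    obtain rfl : i = 0 := by omega
    exact ⟨h1, h2⟩
  | succ J ih =>
    intro hJ
    obtain ⟨v, hv⟩ := ih (by omega)
    have hb := hpos J (by omega)
    have hg := hβ J (by omega)
    set γ : ℝ := β (J + 1) with hγ
    have hγpos : 0 < γ := hpos _ hJ
    -- choose the first full period after the left end of the previous interval
    set t : ℝ := (γ * (u J + Q * v) / (Q * β J) - u (J + 1) / Q) with ht
    refine ⟨⌈t⌉, fun θ h1 h2 => ?_⟩
    have ht1 : t ≤ ⌈t⌉ := Int.le_ceil t
    have ht2 : (⌈t⌉ : ℝ) < t + 1 := Int.ceil_lt_add_one t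
    have hQt : Q * t = γ * (u J + Q * v) / β J - u (J + 1) := by
      rw [ht]; field_simp
    have hr : 2 * Q ≤ γ / β J := by rwa [le_div_iff₀ hb]
    have hr0 : 0 < γ / β J := by positivity
    have e : Q * (γ * θ) = γ / β J * (Q * (β J * θ)) := by field_simp
    have eQt : Q * t = γ / β J * (u J + Q * v) - u (J + 1) := by rw [hQt]; ring
    have h3 : (Q : ℝ) * t ≤ Q * ⌈t⌉ := by gcongr
    have h4 : (Q : ℝ) * ⌈t⌉ ≤ Q * t + Q := by nlinarith
    have hlow : (u J + Q * v : ℝ) ≤ Q * (β J * θ) := by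
      have : γ / β J * (u J + Q * v) ≤ γ / β J * (Q * (β J * θ)) := by linarith
      exact le_of_mul_le_mul_left this hr0
    -- In the variable `Q * (γ * θ)` the old interval has length at least `2 * Q`; the new one
    -- starts at most `Q` after its left end and has length `1`.
    have hup : Q * (β J * θ) ≤ u J + Q * v + 1 := by
      have : γ / β J * (Q * (β J * θ)) ≤ γ / β J * (u J + Q * v + 1) := by nlinarith
      exact le_of_mul_le_mul_left this hr0
    intro i hi
    rcases Nat.lt_or_ge J i with h | h
    · obtain rfl : i = J + 1 := by omega
      exact ⟨_, h1, h2⟩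
    · exact hv θ hlow hup i h

/-- Blocks over which a slowly increasing unbounded function grows by a factor of about `R`. -/
theorem exists_blocks (G : ℕ → ℝ) (hG : Tendsto G atTop atTop) (hmono : Monotone G)
    (hstep : ∀ n, G (n + 1) ≤ G n + 1) (R : ℝ) (hR : 2 ≤ R) (M : ℕ) (hM : 1 ≤ G M) :
    ∃ N : ℕ → ℕ, N 0 = M ∧ StrictMono N ∧ (∀ i, R * G (N i) ≤ G (N (i + 1))) ∧
      ∀ i, G (N i) ≤ (R + 1) ^ i * G M := by
  have hnext : ∀ m, 1 ≤ G m → ∃ n, m < n ∧ R * G m ≤ G n ∧ G n ≤ (R + 1) * G m := by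
    intro m hm
    have hex : ∃ n, R * G m ≤ G n := (hG.eventually_ge_atTop _).exists
    classical
    set n := Nat.find hex with hn
    have hspec : R * G m ≤ G n := Nat.find_spec hex
    have hlt : m < n := by
      by_contra hcon
      have := hmono (not_lt.1 hcon)
      nlinarith
    obtain ⟨k, hk⟩ : ∃ k, n = k + 1 := ⟨n - 1, by omega⟩
    -- The overshoot is at most `1 ≤ G m`, whence the factor `R + 1`.
    have hmin : ¬ R * G m ≤ G k := Nat.find_min hex (by omega)
    have := hstep k
    rw [← hk] at this
    exact ⟨n, hlt, hspec, by nlinarith [not_le.1 hmin]⟩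
  choose! f hf1 hf2 hf3 using hnext
  have hge : ∀ i, 1 ≤ G (f^[i] M) := by
    intro i
    induction i with
    | zero => exact hM
    | succ i ih =>
      rw [Function.iterate_succ_apply']
      exact ih.trans (hmono (hf1 _ ih).le)
  refine ⟨fun i => f^[i] M, rfl, strictMono_nat_of_lt_succ fun i => ?_, fun i => ?_, fun i => ?_⟩
  · simp only [Function.iterate_succ_apply']
    exact hf1 _ (hge i)
  · simp only [Function.iterate_succ_apply']
    exact hf2 _ (hge i)
  · induction i with
    | zero => simp
    | succ i ih =>
      simp only [Function.iterate_succ_apply']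
      have := hf3 _ (hge i)
      rw [pow_succ]
      nlinarith

/-- The choice of parameters: for large `L`, the number `K` of classes is large enough that the
growth along a class is at least `2Q`, yet `Q ^ K` is much smaller than `exp L`. -/
theorem exists_parameters {η δ R g : ℝ} (hη : 0 < η) (hη1 : η < 1) (hδ : 0 < δ) (hR : 0 < R)
    (hg : 0 < g) :
    ∃ (L : ℝ) (K Q : ℕ), 1 ≤ L ∧ 1 ≤ K ∧ 1 ≤ Q ∧ (2 * K : ℝ) ≤ δ * Q ∧
      2 * (Q : ℝ) ≤ (1 + 1 / L ^ (1 - η)) ^ K ∧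
      (R + 1) ^ (Q ^ K) * g ≤ Real.exp (Real.exp L) := by
  set C : ℝ := 4 / δ + 1 with hC
  have hC1 : 1 ≤ C := by rw [hC]; linarith [div_pos four_pos hδ]
  set A : ℝ := Real.log (R + 1) + |Real.log g| + 1 with hA
  have hlogR : 0 ≤ Real.log (R + 1) := Real.log_nonneg (by linarith)
  have hA1 : 1 ≤ A := by rw [hA]; linarith [abs_nonneg (Real.log g)]
  have hη2 : 0 < η / 2 := by positivity
  have ev1 : ∀ᶠ L : ℝ in atTop, Real.log L ≤ 1 / 16 * L ^ (η / 2) := by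
    filter_upwards [(isLittleO_log_rpow_atTop hη2).bound (by norm_num : (0 : ℝ) < 1 / 16),
      eventually_ge_atTop 1] with L h1 h2
    rw [Real.norm_eq_abs, Real.norm_eq_abs, abs_of_nonneg (by positivity : 0 ≤ L ^ (η / 2))] at h1
    exact (le_abs_self _).trans h1
  have ev2 : ∀ᶠ L : ℝ in atTop, 16 * Real.log (2 * C) ≤ L ^ (η / 2) :=
    (tendsto_rpow_atTop hη2).eventually_ge_atTop _
  obtain ⟨L, hL1, hLlog, hLC, hLA⟩ := ((eventually_ge_atTop 1).and
    (ev1.and (ev2.and (eventually_ge_atTop (4 * Real.log A))))).exists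
  have hL0 : 0 < L := by linarith
  have hlog : Real.log (2 * C * L) ≤ L ^ (η / 2) / 8 := by
    rw [Real.log_mul (by positivity) hL0.ne']
    linarith
  -- The exponent lies between `1 - η` and `1`: `K / L ^ (1 - η)` then beats `log Q`, while `K * log
  -- Q` is still small against `L`.
  set K : ℕ := ⌈L ^ (1 - η / 2)⌉₊ with hK
  have hLt1 : 1 ≤ L ^ (1 - η / 2) := Real.one_le_rpow hL1 (by linarith)
  have hLt : L ^ (1 - η / 2) ≤ L := by
    calc L ^ (1 - η / 2) ≤ L ^ (1 : ℝ) := Real.rpow_le_rpow_of_exponent_le hL1 (by linarith)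
      _ = L := Real.rpow_one L
  have hKge : L ^ (1 - η / 2) ≤ K := Nat.le_ceil _
  have hKle : (K : ℝ) ≤ 2 * L ^ (1 - η / 2) := by
    have := (Nat.ceil_lt_add_one (by positivity : 0 ≤ L ^ (1 - η / 2))).le
    linarith
  have hK1 : (1 : ℝ) ≤ K := hLt1.trans hKge
  set Q : ℕ := ⌈2 * K / δ⌉₊ with hQ
  have hQge : 2 * K / δ ≤ Q := Nat.le_ceil _
  have hQpos : 1 ≤ Q := Nat.one_le_ceil_iff.2 (by positivity)
  have hQ1 : (1 : ℝ) ≤ Q := by exact_mod_cast hQpos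
  have hQle : (Q : ℝ) ≤ C * L := by
    have h1 := (Nat.ceil_lt_add_one (by positivity : 0 ≤ 2 * K / δ)).le
    have h2 : 2 * K / δ ≤ 4 / δ * L := by
      rw [div_mul_eq_mul_div]
      exact div_le_div_of_nonneg_right (by linarith) hδ.le
    rw [← hQ] at h1
    rw [hC]
    linarith
  refine ⟨L, K, Q, hL1, by exact_mod_cast hK1, hQpos, ?_, ?_, ?_⟩
  · rw [div_le_iff₀ hδ] at hQge
    linarith
  · set ρ : ℝ := 1 / L ^ (1 - η) with hρ
    have hσ1 : 1 ≤ L ^ (1 - η) := Real.one_le_rpow hL1 (by linarith)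
    have hρ0 : 0 < ρ := by positivity
    have hρ1 : ρ ≤ 1 := by rw [hρ, div_le_one (by positivity)]; exact hσ1
    have hexp : Real.exp (ρ / 2) ≤ 1 + ρ := by
      have h1 := Real.add_one_le_exp (-(ρ / 2))
      have h2 : Real.exp (ρ / 2) * Real.exp (-(ρ / 2)) = 1 := by
        rw [← Real.exp_add]; simp
      have h3 := Real.exp_pos (ρ / 2)
      by_contra hcon
      push Not at hcon
      nlinarith
    have hKρ : L ^ (η / 2) ≤ K * ρ := by
      rw [hρ, mul_one_div, le_div_iff₀ (by positivity), ← Real.rpow_add hL0]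
      rwa [show η / 2 + (1 - η) = 1 - η / 2 by ring]
    calc 2 * (Q : ℝ) ≤ 2 * C * L := by linarith
      _ = Real.exp (Real.log (2 * C * L)) := (Real.exp_log (by positivity)).symm
      _ ≤ Real.exp (K * (ρ / 2)) := by
        apply Real.exp_le_exp.2
        have : 0 < L ^ (η / 2) := by positivity
        linarith
      _ = Real.exp (ρ / 2) ^ K := Real.exp_nat_mul _ _
      _ ≤ (1 + ρ) ^ K := by gcongr
  · have hlogQ : Real.log Q ≤ L ^ (η / 2) / 8 := by
      refine le_trans (Real.log_le_log (by positivity) ?_) hlog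
      nlinarith
    have hlogQ0 : 0 ≤ Real.log Q := Real.log_nonneg hQ1
    have hprod : L ^ (1 - η / 2) * L ^ (η / 2) = L := by
      rw [← Real.rpow_add hL0]; simp
    have hKlog : K * Real.log Q ≤ L / 4 := by
      calc K * Real.log Q ≤ 2 * L ^ (1 - η / 2) * (L ^ (η / 2) / 8) := by gcongr
        _ = L / 4 := by linear_combination hprod / 4
    have hQK : (Q : ℝ) ^ K * A ≤ Real.exp L := by
      have e : (Q : ℝ) ^ K * A = Real.exp (K * Real.log Q + Real.log A) := by
        rw [Real.exp_add, Real.exp_nat_mul, Real.exp_log (by positivity),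
          Real.exp_log (by positivity)]
      rw [e]
      apply Real.exp_le_exp.2
      linarith
    have hQK1 : (1 : ℝ) ≤ (Q : ℝ) ^ K := one_le_pow₀ hQ1
    have e : (R + 1) ^ (Q ^ K) * g =
        Real.exp ((Q : ℝ) ^ K * Real.log (R + 1) + Real.log g) := by
      rw [Real.exp_add, Real.exp_log hg, ← Nat.cast_pow, Real.exp_nat_mul,
        Real.exp_log (by positivity)]
    rw [e]
    apply Real.exp_le_exp.2
    refine le_trans ?_ hQK
    have h1 := le_abs_self (Real.log g)
    have h2 := abs_nonneg (Real.log g)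
    rw [hA]
    nlinarith

/-- For a sequence `b` growing fast enough relative to `G`, finitely many rotations realize every
pattern of `K` cells out of `Q`, each on a block carrying most of the mass of `G`. -/
theorem exists_rotations_realizing_patterns (G : ℕ → ℝ) (hG : Tendsto G atTop atTop)
    (hmono : Monotone G) (hstep : ∀ n, G (n + 1) ≤ G n + 1) (b : ℕ → ℕ) {η : ℝ} (hη : 0 < η)
    (hη1 : η < 1) (hb0 : ∀ᶠ n in atTop, 0 < b n)
    (hb : ∀ᶠ n in atTop, (1 + 1 / Real.log (Real.log (G n)) ^ (1 - η)) * b n ≤ b (n + 1))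
    {δ : ℝ} (hδ : 0 < δ) (M : ℕ) :
    ∃ (K Q Nend : ℕ) (θ : Fin K → ℝ), 1 ≤ Q ∧ (2 * K : ℝ) ≤ δ * Q ∧ ∀ c : Fin K → Fin Q,
      ∃ N' N, M ≤ N' ∧ N' < N ∧ N ≤ Nend ∧ G N' ≤ δ * G N ∧
        ∀ n, N' < n → n ≤ N → ∃ (j : Fin K) (z : ℤ),
          ((c j : ℕ) + Q * z : ℝ) ≤ Q * (b n * θ j) ∧
          Q * (b n * θ j) ≤ (c j : ℕ) + Q * z + 1 := by
  obtain ⟨n₁, hn₁⟩ := eventually_atTop.1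
    (hb0.and (hb.and (hG.eventually_ge_atTop (Real.exp (Real.exp 1)))))
  set M₀ := max M n₁ with hM₀
  have hn : ∀ n ≥ M₀, 0 < b n ∧
      (1 + 1 / Real.log (Real.log (G n)) ^ (1 - η)) * b n ≤ b (n + 1) ∧
      Real.exp (Real.exp 1) ≤ G n := fun n h => hn₁ n (le_trans (le_max_right _ _) h)
  have hGM : 1 ≤ G M₀ := le_trans (Real.one_le_exp (Real.exp_pos _).le) (hn M₀ le_rfl).2.2
  -- The bound `1 / δ` leaves at most a fraction `δ` of the weight before each block.
  set R : ℝ := max 2 (1 / δ) with hR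
  have hR2 : 2 ≤ R := le_max_left _ _
  have hRδ : 1 ≤ δ * R := by
    have := le_max_right 2 (1 / δ)
    rw [div_le_iff₀ hδ] at this
    linarith
  obtain ⟨L, K, Q, hL1, hK1, hQ1, hKQ, hgrow, hsize⟩ :=
    exists_parameters (R := R) (g := G M₀) hη hη1 hδ (by linarith) (by linarith)
  obtain ⟨N, hN0, hNmono, hNR, hNup⟩ := exists_blocks G hG hmono hstep R hR2 M₀ hGM
  set Nend := N (Q ^ K) with hNend
  have hGend : G Nend ≤ Real.exp (Real.exp L) := (hNup _).trans hsize
  have hratio : ∀ n, M₀ ≤ n → n ≤ Nend → (1 + 1 / L ^ (1 - η)) * b n ≤ b (n + 1) := by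
    intro n h1 h2
    obtain ⟨-, h4, h5⟩ := hn n h1
    have h6 := (hmono h2).trans hGend
    have h7 : 1 ≤ Real.log (Real.log (G n)) := by
      have := Real.log_le_log (Real.exp_pos _) h5
      rw [Real.log_exp] at this
      have := Real.log_le_log (Real.exp_pos _) this
      rwa [Real.log_exp] at this
    have h8 : Real.log (Real.log (G n)) ≤ L := by
      have hl := Real.log_le_log (Real.exp_pos _) h5
      rw [Real.log_exp] at hl
      have := Real.log_le_log (lt_of_lt_of_le (Real.exp_pos _) h5) h6
      rw [Real.log_exp] at this
      have := Real.log_le_log (lt_of_lt_of_le (Real.exp_pos _) hl) this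
      rwa [Real.log_exp] at this
    refine le_trans ?_ h4
    have h9 : Real.log (Real.log (G n)) ^ (1 - η) ≤ L ^ (1 - η) :=
      Real.rpow_le_rpow (by linarith) h8 (by linarith)
    have h10 : 0 < Real.log (Real.log (G n)) ^ (1 - η) := by positivity
    gcongr
  have hiter : ∀ k n, M₀ ≤ n → n + k ≤ Nend → (1 + 1 / L ^ (1 - η)) ^ k * b n ≤ b (n + k) := by
    intro k n h1 h2
    induction k with
    | zero => simp
    | succ k ih =>
      have h3 := ih (by omega)
      have h4 := hratio (n + k) (by omega) (by omega)
      have h5 : 0 ≤ 1 + 1 / L ^ (1 - η) := by positivity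
      calc (1 + 1 / L ^ (1 - η)) ^ (k + 1) * b n
          = (1 + 1 / L ^ (1 - η)) * ((1 + 1 / L ^ (1 - η)) ^ k * b n) := by ring
        _ ≤ (1 + 1 / L ^ (1 - η)) * b (n + k) := by gcongr
        _ ≤ b (n + k + 1) := h4
  let e : (Fin K → Fin Q) ≃ Fin (Q ^ K) := Fintype.equivFinOfCardEq (by simp)
  -- the prescribed cell at time `n` for class `j`
  have hu : ∃ u : ℕ → Fin K → ℤ, ∀ (c : Fin K → Fin Q) (n : ℕ), N (e c) < n →
      n ≤ N (e c + 1) → ∀ j, u n j = (c j : ℕ) := by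
    classical
    -- The half-open blocks are disjoint, so the pattern is unique; times in no block, such as `M₀`,
    -- get `0`.
    refine ⟨fun n j => if h : ∃ c : Fin K → Fin Q, N (e c) < n ∧ n ≤ N (e c + 1) then
      ((h.choose j : ℕ) : ℤ) else 0, fun c n h1 h2 j => ?_⟩
    have hex : ∃ c : Fin K → Fin Q, N (e c) < n ∧ n ≤ N (e c + 1) := ⟨c, h1, h2⟩
    obtain ⟨h3, h4⟩ := hex.choose_spec
    have h5 : hex.choose = c := by
      apply e.injective
      apply Fin.ext
      have h6 := hNmono.lt_iff_lt.1 (lt_of_lt_of_le h1 h4)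
      have h7 := hNmono.lt_iff_lt.1 (lt_of_lt_of_le h3 h2)
      omega
    simp only [dif_pos hex, h5]
  obtain ⟨u, hu⟩ := hu
  -- One angle per residue class of `n - M₀` modulo `K`, serving all blocks at once.
  have hθ : ∀ j : Fin K, ∃ θ : ℝ, ∀ i ≤ (Nend - M₀ - j) / K, ∃ z : ℤ,
      (u (M₀ + j + K * i) j + Q * z : ℝ) ≤ Q * (b (M₀ + j + K * i) * θ) ∧
      Q * (b (M₀ + j + K * i) * θ) ≤ u (M₀ + j + K * i) j + Q * z + 1 := by
    intro j
    refine exists_rotation Q hQ1 (fun i => b (M₀ + j + K * i)) (fun i => u (M₀ + j + K * i) j)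
      (by exact_mod_cast (hn _ (by omega)).1) _ fun i hi => ?_
    have h1 : K * (i + 1) ≤ Nend - M₀ - j := by
      rw [mul_comm]
      exact (Nat.le_div_iff_mul_le (by omega)).1 hi
    rw [mul_add, mul_one] at h1
    have h2 := hiter K (M₀ + j + K * i) (by omega) (by omega)
    have h3 : M₀ + ↑j + K * (i + 1) = M₀ + j + K * i + K := by ring
    simp only [h3]
    refine le_trans ?_ h2
    gcongr
  choose θ hθ using hθ
  refine ⟨K, Q, Nend, θ, hQ1, hKQ, fun c => ?_⟩
  have hM₀N : M₀ ≤ N (e c) := hN0 ▸ hNmono.monotone (Nat.zero_le _)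
  have hNe : N (e c + 1) ≤ Nend := hNmono.monotone (e c).isLt
  refine ⟨N (e c), N (e c + 1), le_trans (le_max_left _ _) hM₀N, hNmono (Nat.lt_succ_self _),
    hNe, ?_, fun n h1 h2 => ?_⟩
  · have h1 := hNR (e c)
    have h2 : 1 ≤ G (N (e c)) := hGM.trans (hmono hM₀N)
    calc G (N (e c)) ≤ δ * R * G (N (e c)) := by nlinarith
      _ = δ * (R * G (N (e c))) := by ring
      _ ≤ δ * G (N (e c + 1)) := by gcongr
  · have hmod : (n - M₀) % K < K := Nat.mod_lt _ (by omega)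
    have hdiv := Nat.mod_add_div (n - M₀) K
    have hle : (n - M₀) / K ≤ (Nend - M₀ - (n - M₀) % K) / K := by
      rw [Nat.le_div_iff_mul_le (by omega), mul_comm]
      omega
    obtain ⟨z, hz⟩ := hθ ⟨_, hmod⟩ _ hle
    have hn' : M₀ + (n - M₀) % K + K * ((n - M₀) / K) = n := by omega
    refine ⟨⟨_, hmod⟩, z, ?_⟩
    simp only [hn', hu c n h1 h2] at hz
    exact_mod_cast hz

end Combinatorics

/-! ### Absorbing sets in finite windows -/

section Sweeping

variable {w : ℕ → ℝ}

theorem monotone_partialSum (hw : ∀ n, 1 ≤ n → w n ∈ Set.Ioc (0 : ℝ) 1) :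
    Monotone (partialSum w) := by
  intro m n hmn
  exact Finset.sum_le_sum_of_subset_of_nonneg (Finset.Icc_subset_Icc_right hmn)
    fun i hi _ => (hw i (Finset.mem_Icc.1 hi).1).1.le

theorem partialSum_nonneg (hw : ∀ n, 1 ≤ n → w n ∈ Set.Ioc (0 : ℝ) 1) (n : ℕ) :
    0 ≤ partialSum w n :=
  Finset.sum_nonneg fun i hi => (hw i (Finset.mem_Icc.1 hi).1).1.le

theorem partialSum_succ_le (hw : ∀ n, 1 ≤ n → w n ∈ Set.Ioc (0 : ℝ) 1) (n : ℕ) :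
    partialSum w (n + 1) ≤ partialSum w n + 1 := by
  rw [partialSum, Finset.sum_Icc_succ_top (by omega)]
  exact add_le_add_right (hw _ (by omega)).2 _

theorem partialSum_sub_le_sum_indicator (hw : ∀ n, 1 ≤ n → w n ∈ Set.Ioc (0 : ℝ) 1)
    {X : Type*} {E : Set X} {y : ℕ → X} {N' N : ℕ} (hN : N' ≤ N)
    (h : ∀ n, N' < n → n ≤ N → y n ∈ E) :
    partialSum w N - partialSum w N' ≤
      ∑ n ∈ Finset.Icc 1 N, w n * E.indicator (fun _ => (1 : ℝ)) (y n) := by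
  have hsplit : ∀ f : ℕ → ℝ, ∑ n ∈ Finset.Icc 1 N, f n =
      ∑ n ∈ Finset.Icc 1 N', f n + ∑ n ∈ Finset.Ioc N' N, f n := by
    intro f
    have h1 : Finset.Icc 1 N = Finset.Ioc 0 N := rfl
    have h2 : Finset.Icc 1 N' = Finset.Ioc 0 N' := rfl
    rw [h1, h2, Finset.sum_Ioc_consecutive _ (Nat.zero_le _) hN]
  rw [partialSum, partialSum, hsplit w, hsplit]
  have h1 : 0 ≤ ∑ n ∈ Finset.Icc 1 N', w n * E.indicator (fun _ => (1 : ℝ)) (y n) :=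
    Finset.sum_nonneg fun n hn => mul_nonneg (hw n (Finset.mem_Icc.1 hn).1).1.le
      (Set.indicator_nonneg (fun _ _ => zero_le_one) _)
  have h2 : ∑ n ∈ Finset.Ioc N' N, w n * E.indicator (fun _ => (1 : ℝ)) (y n) =
      ∑ n ∈ Finset.Ioc N' N, w n := by
    refine Finset.sum_congr rfl fun n hn => ?_
    rw [Finset.mem_Ioc] at hn
    rw [Set.indicator_of_mem (h n hn.1 hn.2), mul_one]
  linarith

/-- Among the `Q` shifts of a pattern of `K` circle-valued functions, one is small. -/
theorem exists_shift_small {X : Type*} [MeasurableSpace X] (μ : Measure X)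
    [IsProbabilityMeasure μ] {K Q : ℕ} [NeZero Q] (κ : Fin K → X → ZMod Q)
    (hκ : ∀ j s, MeasurableSet (κ j ⁻¹' {s})) {δ : ℝ} (hKQ : (2 * K : ℝ) ≤ δ * Q) :
    ∃ s, μ.real {x | ∃ j, κ j x = s ∨ κ j x = s - 1} ≤ δ := by
  have hfib : ∀ j, ∑ s, μ.real (κ j ⁻¹' {s}) = 1 := by
    intro j
    have h1 := sum_measureReal_preimage_singleton (μ := μ) (f := κ j) Finset.univ
      (fun s _ => hκ j s)
    rw [h1]
    simp
  have hle : ∀ s, μ.real {x | ∃ j, κ j x = s ∨ κ j x = s - 1} ≤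
      ∑ j, (μ.real (κ j ⁻¹' {s}) + μ.real (κ j ⁻¹' {s - 1})) := by
    intro s
    have : {x | ∃ j, κ j x = s ∨ κ j x = s - 1} =
        ⋃ j, (κ j ⁻¹' {s} ∪ κ j ⁻¹' {s - 1}) := by ext; simp
    rw [this]
    exact (measureReal_iUnion_fintype_le _).trans
      (Finset.sum_le_sum fun j _ => measureReal_union_le _ _)
  have hsum : ∑ s, μ.real {x | ∃ j, κ j x = s ∨ κ j x = s - 1} ≤ ∑ _s : ZMod Q, δ := by
    refine (Finset.sum_le_sum fun s _ => hle s).trans ?_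
    rw [Finset.sum_comm]
    -- For each `j` a point is counted for exactly two values of `s`, so the total is `2 * K ≤ δ *
    -- Q`.
    have h2 : ∀ j, ∑ s, (μ.real (κ j ⁻¹' {s}) + μ.real (κ j ⁻¹' {s - 1})) = 2 := by
      intro j
      rw [Finset.sum_add_distrib, hfib,
        Fintype.sum_equiv (Equiv.subRight 1) (fun s => μ.real (κ j ⁻¹' {s - 1}))
          (fun s => μ.real (κ j ⁻¹' {s})) (fun s => by simp), hfib]
      norm_num
    simp only [h2, Finset.sum_const, Finset.card_univ, Fintype.card_fin, ZMod.card, nsmul_eq_mul]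
    linarith
  obtain ⟨s, -, hs⟩ := Finset.exists_le_of_sum_le Finset.univ_nonempty hsum
  exact ⟨s, hs⟩

/-- Knowing `b` only up to an interval of length `1` leaves two candidates for the floor, which is
why the absorbing set consists of two adjacent cells. -/
theorem floor_sub_cast_zmod {Q : ℕ} {a b : ℝ} {c : ℕ} {z : ℤ} {s : ZMod Q}
    (hc : (c : ZMod Q) = (⌊a⌋ : ZMod Q) - s) (h1 : (c + Q * z : ℝ) ≤ b)
    (h2 : b ≤ c + Q * z + 1) :
    ((⌊a - b⌋ : ℤ) : ZMod Q) = s ∨ ((⌊a - b⌋ : ℤ) : ZMod Q) = s - 1 := by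
  have e1 : ⌊a⌋ - (c + Q * z) - 1 ≤ ⌊a - b⌋ := by
    rw [Int.le_floor]
    push_cast
    linarith [Int.floor_le a]
  have e2 : ⌊a - b⌋ < ⌊a⌋ - (c + Q * z) + 1 := by
    rw [Int.floor_lt]
    push_cast
    linarith [Int.lt_floor_add_one a]
  have e3 : ⌊a - b⌋ = ⌊a⌋ - (c + Q * z) ∨ ⌊a - b⌋ = ⌊a⌋ - (c + Q * z) - 1 := by omega
  rcases e3 with h | h
  · left
    rw [h]; push_cast; rw [hc]; simp
  · right
    rw [h]; push_cast; rw [hc]; simp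

/-- In a finite window of times, a small set absorbs almost all of the weighted orbit of most
points. -/
theorem exists_absorbing_set {X : Type*} [MeasurableSpace X] {μ : Measure X}
    [IsProbabilityMeasure μ] {T : X → X} (hT : MeasurePreserving T μ μ) (hap : Aperiodic μ T)
    (hw : ∀ n, 1 ≤ n → w n ∈ Set.Ioc (0 : ℝ) 1) (hG : Tendsto (partialSum w) atTop atTop)
    (b : ℕ → ℕ) {η : ℝ} (hη : 0 < η) (hη1 : η < 1) (hb0 : ∀ᶠ n in atTop, 0 < b n)
    (hb : ∀ᶠ n in atTop,
      (1 + 1 / Real.log (Real.log (partialSum w n)) ^ (1 - η)) * b n ≤ b (n + 1))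
    {S : ℕ → X → X} (hS : ∀ᶠ n in atTop, S n = T^[b n]) {δ : ℝ} (hδ : 0 < δ) (M : ℕ) :
    ∃ (Nend : ℕ) (H : Set X), M ≤ Nend ∧ MeasurableSet H ∧ μ H ≤ ENNReal.ofReal δ ∧
      μ {x | ¬ ∃ N, M ≤ N ∧ N ≤ Nend ∧ (1 - δ) * partialSum w N ≤
        ∑ n ∈ Finset.Icc 1 N, w n * H.indicator (fun _ => (1 : ℝ)) (S n x)} ≤
        ENNReal.ofReal δ := by
  obtain ⟨n₀, hn₀⟩ := eventually_atTop.1 hS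
  obtain ⟨K, Q, Nend, θ, hQ, hKQ, hpat⟩ := exists_rotations_realizing_patterns (partialSum w) hG
    (monotone_partialSum hw) (partialSum_succ_le hw) b hη hη1 hb0 hb hδ (max M n₀)
  have : NeZero Q := ⟨by omega⟩
  -- The height must behave at all times `b n` with `n ≤ Nend`.
  obtain ⟨h, hh, hbad⟩ := hap.exists_height hT ((Finset.range (Nend + 1)).sup b) hδ
  set κ : Fin K → X → ZMod Q := fun j x => (⌊Q * (h x * θ j)⌋ : ZMod Q) with hκ
  obtain ⟨s, hs⟩ := exists_shift_small μ κ
    (fun j s => hh (MeasurableSet.of_discrete (s := {m : ℤ | (⌊Q * (m * θ j)⌋ : ZMod Q) = s})))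
    hKQ
  set H : Set X := {x | ∃ j, κ j x = s ∨ κ j x = s - 1} with hH
  have hHm : MeasurableSet H := hh (MeasurableSet.of_discrete (s := {m : ℤ |
    ∃ j, (⌊Q * (m * θ j)⌋ : ZMod Q) = s ∨ (⌊Q * (m * θ j)⌋ : ZMod Q) = s - 1}))
  refine ⟨Nend, H, ?_, hHm, ?_, (measure_mono ?_).trans hbad⟩
  · obtain ⟨N', N, h1, h2, h3, -⟩ := hpat fun _ => 0
    exact ((le_max_left M n₀).trans h1).trans (h2.le.trans h3)
  · rw [← ofReal_measureReal]
    exact ENNReal.ofReal_le_ofReal hs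
  · intro x hx hgood
    apply hx
    -- The pattern, and hence the block, depends on `x`: it moves every cell `κ j x` to `s`, up to
    -- rounding.
    obtain ⟨N', N, h1, h2, h3, h4, h5⟩ :=
      hpat fun j => ⟨(κ j x - s).val, ZMod.val_lt _⟩
    have hM := (le_max_left M n₀).trans h1
    have hn0 := (le_max_right M n₀).trans h1
    refine ⟨N, hM.trans h2.le, h3, le_trans ?_
      (partialSum_sub_le_sum_indicator hw h2.le fun n hn hnN => ?_)⟩
    · linarith
    · obtain ⟨j, z, hz1, hz2⟩ := h5 n hn hnN
      rw [hn₀ n (by omega)]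
      have hhb := hgood (b n) (Finset.le_sup (f := b) (Finset.mem_range.2 (by omega)))
      refine ⟨j, ?_⟩
      have e : (Q : ℝ) * (h (T^[b n] x) * θ j) = Q * (h x * θ j) - Q * (b n * θ j) := by
        rw [hhb]; push_cast; ring
      simp only [hκ, e]
      exact floor_sub_cast_zmod (by simp [hκ]) hz1 hz2

/-! ### Gluing windows into one sweeping set -/

theorem weightedAverage_nonneg (hw : ∀ n, 1 ≤ n → w n ∈ Set.Ioc (0 : ℝ) 1) {X : Type*}
    (E : Set X) (y : ℕ → X) (N : ℕ) :
    0 ≤ weightedAverage w (fun n => E.indicator (fun _ => (1 : ℝ)) (y n)) N :=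
  div_nonneg (Finset.sum_nonneg fun n hn => mul_nonneg (hw n (Finset.mem_Icc.1 hn).1).1.le
    (Set.indicator_nonneg (fun _ _ => zero_le_one) _)) (partialSum_nonneg hw N)

theorem weightedAverage_le_one (hw : ∀ n, 1 ≤ n → w n ∈ Set.Ioc (0 : ℝ) 1) {X : Type*}
    (E : Set X) (y : ℕ → X) (N : ℕ) :
    weightedAverage w (fun n => E.indicator (fun _ => (1 : ℝ)) (y n)) N ≤ 1 := by
  refine div_le_one_of_le₀ (Finset.sum_le_sum fun n hn => ?_) (partialSum_nonneg hw N)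
  exact mul_le_of_le_one_right (hw n (Finset.mem_Icc.1 hn).1).1.le
    (Set.indicator_le' (fun _ _ => le_rfl) (fun _ _ => zero_le_one) _)

theorem limsup_eq_one_of_frequently {f : ℕ → ℝ} (h0 : ∀ N, 0 ≤ f N) (h1 : ∀ N, f N ≤ 1)
    (h : ∀ e > 0, ∃ᶠ N in atTop, 1 - e ≤ f N) : limsup f atTop = 1 := by
  have hb : IsBoundedUnder (· ≤ ·) atTop f := isBoundedUnder_of ⟨1, h1⟩
  have hc : IsCoboundedUnder (· ≤ ·) atTop f :=
    (isBoundedUnder_of ⟨0, h0⟩ : IsBoundedUnder (· ≥ ·) atTop f).isCoboundedUnder_le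
  refine le_antisymm (limsup_le_of_le hc (Eventually.of_forall h1)) ?_
  refine le_of_forall_pos_sub_le fun e he => ?_
  exact le_limsup_of_frequently_le (h e he) hb

theorem liminf_eq_zero_of_frequently {f : ℕ → ℝ} (h0 : ∀ N, 0 ≤ f N) (h1 : ∀ N, f N ≤ 1)
    (h : ∀ e > 0, ∃ᶠ N in atTop, f N ≤ e) : liminf f atTop = 0 := by
  have hb : IsBoundedUnder (· ≥ ·) atTop f := isBoundedUnder_of ⟨0, h0⟩
  have hc : IsCoboundedUnder (· ≥ ·) atTop f :=
    (isBoundedUnder_of ⟨1, h1⟩ : IsBoundedUnder (· ≤ ·) atTop f).isCoboundedUnder_ge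
  refine le_antisymm ?_ (le_liminf_of_le hc (Eventually.of_forall h0))
  refine le_of_forall_pos_le_add fun e he => ?_
  rw [zero_add]
  exact liminf_le_of_frequently_le (h e he) hb

/-- Gluing: if small sets absorb almost all of the weighted orbit in arbitrarily late finite windows,
then the averages sweep out. -/
theorem sweepsOut_of_absorbing_sets {X : Type*} [MeasurableSpace X] {μ : Measure X}
    [IsProbabilityMeasure μ] (hw : ∀ n, 1 ≤ n → w n ∈ Set.Ioc (0 : ℝ) 1)
    (hG : Tendsto (partialSum w) atTop atTop) {S : ℕ → X → X}
    (hS : ∀ n, 1 ≤ n → MeasurePreserving (S n) μ μ)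
    (h : ∀ δ : ℝ, 0 < δ → ∀ M : ℕ, ∃ (Nend : ℕ) (H : Set X), M ≤ Nend ∧ MeasurableSet H ∧
      μ H ≤ ENNReal.ofReal δ ∧
      μ {x | ¬ ∃ N, M ≤ N ∧ N ≤ Nend ∧ (1 - δ) * partialSum w N ≤
        ∑ n ∈ Finset.Icc 1 N, w n * H.indicator (fun _ => (1 : ℝ)) (S n x)} ≤
        ENNReal.ofReal δ) :
    SweepsOut μ w S := by
  intro ε hε
  choose! Nf Hf hMN hHm hHs hHbad using h
  -- Dividing by `m + 1` keeps even the union of the first `m` preimages of the set summably small.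
  set d : ℕ → ℕ → ℝ := fun k m => min 1 ε / 4 * (1 / 2) ^ k / (m + 1) with hd
  have hε' : 0 < min 1 ε := lt_min one_pos hε
  have hdpos : ∀ k m, 0 < d k m := fun k m => by positivity
  have hdle : ∀ k m, (m + 1) * d k m ≤ min 1 ε / 4 * (1 / 2) ^ k := fun k m => by
    rw [hd]; field_simp; rfl
  have hdle' : ∀ k m, d k m ≤ min 1 ε / 4 * (1 / 2) ^ k := fun k m =>
    div_le_self (by positivity) (by linarith [(Nat.cast_nonneg m : (0 : ℝ) ≤ m)])
  set N : ℕ → ℕ := fun k => Nat.rec 0 (fun k m => Nf (d k m) (max k m)) k with hN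
  have hNs : ∀ k, N (k + 1) = Nf (d k (N k)) (max k (N k)) := fun k => rfl
  set H : ℕ → Set X := fun k => Hf (d k (N k)) (max k (N k)) with hH
  set D : ℕ → ℝ := fun k => d k (N k) with hD
  have hDpos : ∀ k, 0 < D k := fun k => hdpos _ _
  have hHm' : ∀ k, MeasurableSet (H k) := fun k => hHm _ (hDpos k) _
  have hHs' : ∀ k, μ (H k) ≤ ENNReal.ofReal (D k) := fun k => hHs _ (hDpos k) _
  have hNmono : Monotone N := monotone_nat_of_le_succ fun k =>
    (le_max_right _ _).trans (hMN _ (hDpos k) _)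
  set Bad : ℕ → Set X := fun k => {x | ¬ ∃ n, max k (N k) ≤ n ∧ n ≤ N (k + 1) ∧
    (1 - D k) * partialSum w n ≤
        ∑ i ∈ Finset.Icc 1 n, w i * (H k).indicator (fun _ => (1 : ℝ)) (S i x)} with hBad
  have hgeo : ∑' k : ℕ, ENNReal.ofReal (min 1 ε / 4 * (1 / 2) ^ k) =
      ENNReal.ofReal (min 1 ε / 2) := by
    rw [← ENNReal.ofReal_tsum_of_nonneg (fun k => by positivity)
      (summable_geometric_two.mul_left _), tsum_mul_left, tsum_geometric_two]
    congr 1; ring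
  have hBadsum : ∑' k, μ (Bad k) ≠ ⊤ := by
    refine ne_top_of_le_ne_top (ENNReal.ofReal_ne_top (r := min 1 ε / 2)) ?_
    rw [← hgeo]
    exact ENNReal.tsum_le_tsum fun k =>
      (hHbad _ (hDpos k) _).trans (ENNReal.ofReal_le_ofReal (hdle' _ _))
  -- Points whose orbit visits `H k` already during the earlier windows.
  set V : ℕ → Set X := fun k => ⋃ i ∈ Finset.Icc 1 (N k), S i ⁻¹' H k with hV
  have hVsum : ∑' k, μ (V k) ≠ ⊤ := by
    refine ne_top_of_le_ne_top (ENNReal.ofReal_ne_top (r := min 1 ε / 2)) ?_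
    rw [← hgeo]
    refine ENNReal.tsum_le_tsum fun k => ?_
    calc μ (V k) ≤ ∑ i ∈ Finset.Icc 1 (N k), μ (S i ⁻¹' H k) := measure_biUnion_finset_le _ _
      _ = ∑ i ∈ Finset.Icc 1 (N k), μ (H k) := Finset.sum_congr rfl fun i hi =>
        (hS i (Finset.mem_Icc.1 hi).1).measure_preimage (hHm' k).nullMeasurableSet
      _ = N k * μ (H k) := by simp
      _ ≤ ENNReal.ofReal (N k) * ENNReal.ofReal (D k) := by
        rw [ENNReal.ofReal_natCast]; gcongr; exact hHs' k
      _ = ENNReal.ofReal (N k * D k) := (ENNReal.ofReal_mul (Nat.cast_nonneg _)).symm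
      _ ≤ _ := ENNReal.ofReal_le_ofReal (by have := hdle k (N k); have := hDpos k; nlinarith)
  -- Later sets override earlier ones: an odd `H j` also clears what earlier even sets contributed.
  set E : Set X := ⋃ i, H (2 * i) \ ⋃ j, ⋃ (_ : 2 * i < j), H j with hE
  have hmemE : ∀ y, y ∈ E ↔ ∃ i, y ∈ H (2 * i) ∧ ∀ j, 2 * i < j → y ∉ H j := by
    intro y; simp [hE]
  have hEm : MeasurableSet E := MeasurableSet.iUnion fun i => (hHm' _).diff
    (MeasurableSet.iUnion fun j => MeasurableSet.iUnion fun _ => hHm' j)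
  have hEμ : μ E ≤ ENNReal.ofReal (min 1 ε / 2) := by
    have hsub : E ⊆ ⋃ k, H k := by
      intro y hy
      obtain ⟨i, hi, -⟩ := (hmemE y).1 hy
      exact Set.mem_iUnion.2 ⟨_, hi⟩
    refine (measure_mono hsub).trans ((measure_iUnion_le _).trans ?_)
    rw [← hgeo]
    exact ENNReal.tsum_le_tsum fun k =>
      (hHs' k).trans (ENNReal.ofReal_le_ofReal (hdle' _ _))
  refine ⟨E, hEm, ?_, ?_⟩
  · have h1 := ENNReal.toReal_mono ENNReal.ofReal_ne_top hEμ
    rw [ENNReal.toReal_ofReal (by positivity)] at h1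
    have h2 := min_le_right 1 ε
    exact lt_of_le_of_lt h1 (by linarith)
  filter_upwards [ae_eventually_notMem hBadsum, ae_eventually_notMem hVsum] with x hx1 hx2
  obtain ⟨k₀, hk₀⟩ := eventually_atTop.1 (hx1.and hx2)
  have hwin : ∀ k ≥ k₀, ∃ n, k ≤ n ∧
      (1 - D k) * partialSum w n ≤
        ∑ i ∈ Finset.Icc 1 n, w i * (H k).indicator (fun _ => (1 : ℝ)) (S i x) ∧
      ∀ i ∈ Finset.Icc 1 n, ∀ j, k < j → S i x ∉ H j := by
    intro k hk
    have h1 := (hk₀ k hk).1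
    simp only [hBad, Set.mem_ofPred_eq, not_not] at h1
    obtain ⟨n, h2, h3, h4⟩ := h1
    refine ⟨n, (le_max_left _ _).trans h2, h4, fun i hi j hj hij => ?_⟩
    refine (hk₀ j (by omega)).2 (Set.mem_iUnion₂.2 ⟨i, ?_, hij⟩)
    rw [Finset.mem_Icc] at hi ⊢
    exact ⟨hi.1, hi.2.trans (h3.trans (hNmono hj))⟩
  have hDlim : Tendsto D atTop (𝓝 0) := by
    refine squeeze_zero (fun k => (hDpos k).le) (fun k => hdle' _ _) ?_
    have := (tendsto_pow_atTop_nhds_zero_of_lt_one (r := (1 / 2 : ℝ)) (by norm_num)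
      (by norm_num)).const_mul (min 1 ε / 4)
    simpa using this
  have hfreq : ∀ e > 0, ∀ m₀ : ℕ, ∃ i, m₀ ≤ 2 * i ∧ k₀ ≤ 2 * i ∧ D (2 * i) ≤ e ∧
      D (2 * i + 1) ≤ e ∧ 0 < partialSum w (2 * i) := by
    intro e he m₀
    obtain ⟨k₁, hk₁⟩ := eventually_atTop.1 ((hDlim.eventually_le_const he).and
      (hG.eventually_gt_atTop 0))
    refine ⟨m₀ + k₀ + k₁, by omega, by omega, (hk₁ _ (by omega)).1, (hk₁ _ (by omega)).1,
      (hk₁ _ (by omega)).2⟩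
  constructor
  · refine limsup_eq_one_of_frequently (weightedAverage_nonneg hw E _)
      (weightedAverage_le_one hw E _) fun e he => ?_
    rw [frequently_atTop]
    intro m₀
    obtain ⟨i, hi0, hik, hie, -, hipos⟩ := hfreq e he m₀
    obtain ⟨n, hn1, hn2, hn3⟩ := hwin (2 * i) hik
    have hpos : 0 < partialSum w n := hipos.trans_le (monotone_partialSum hw hn1)
    refine ⟨n, by omega, ?_⟩
    rw [weightedAverage, le_div_iff₀ hpos]
    calc (1 - e) * partialSum w n ≤ (1 - D (2 * i)) * partialSum w n := by gcongr
      _ ≤ _ := hn2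
      _ ≤ _ := by
        refine Finset.sum_le_sum fun l hl => ?_
        refine mul_le_mul_of_nonneg_left ?_ (hw l (Finset.mem_Icc.1 hl).1).1.le
        by_cases hlH : S l x ∈ H (2 * i)
        · rw [Set.indicator_of_mem hlH,
            Set.indicator_of_mem ((hmemE _).2 ⟨i, hlH, fun j hj => hn3 l hl j hj⟩)]
        · rw [Set.indicator_of_notMem hlH]
          exact Set.indicator_nonneg (fun _ _ => zero_le_one) _
  · refine liminf_eq_zero_of_frequently (weightedAverage_nonneg hw E _)
      (weightedAverage_le_one hw E _) fun e he => ?_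
    rw [frequently_atTop]
    intro m₀
    obtain ⟨i, hi0, hik, -, hie, hipos⟩ := hfreq e he m₀
    obtain ⟨n, hn1, hn2, hn3⟩ := hwin (2 * i + 1) (by omega)
    have hpos : 0 < partialSum w n := hipos.trans_le (monotone_partialSum hw (by omega))
    refine ⟨n, by omega, ?_⟩
    rw [weightedAverage, div_le_iff₀ hpos]
    -- In an odd window no time counts for both `E` and `H (2 * i + 1)`: earlier even sets had it
    -- removed, and later ones are not visited yet.
    have hsum : ∑ l ∈ Finset.Icc 1 n, w l * E.indicator (fun _ => (1 : ℝ)) (S l x) +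
        ∑ l ∈ Finset.Icc 1 n, w l * (H (2 * i + 1)).indicator (fun _ => (1 : ℝ)) (S l x) ≤
        partialSum w n := by
      rw [← Finset.sum_add_distrib]
      refine Finset.sum_le_sum fun l hl => ?_
      rw [← mul_add]
      refine mul_le_of_le_one_right (hw l (Finset.mem_Icc.1 hl).1).1.le ?_
      by_cases hlH : S l x ∈ H (2 * i + 1)
      · have hlE : S l x ∉ E := by
          rw [hmemE]
          rintro ⟨i', hi', hlater⟩
          rcases Nat.lt_or_ge (2 * i') (2 * i + 1) with hlt | hge
          · exact hlater _ hlt hlH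
          · exact hn3 l hl (2 * i') (by omega) hi'
        rw [Set.indicator_of_mem hlH, Set.indicator_of_notMem hlE, zero_add]
      · rw [Set.indicator_of_notMem hlH, add_zero]
        exact Set.indicator_le' (fun _ _ => le_rfl) (fun _ _ => zero_le_one) _
    have : D (2 * i + 1) * partialSum w n ≤ e * partialSum w n := by gcongr
    linarith

/-- A sequence of maps that eventually consists of the powers `T ^ (b n)` of an aperiodic map, for
`b` growing fast enough relative to the partial sums of `w`, sweeps out. -/
theorem Aperiodic.sweepsOut_of_growth {X : Type*} [MeasurableSpace X] {μ : Measure X}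
    [IsProbabilityMeasure μ] {T : X → X} (hap : Aperiodic μ T) (hT : MeasurePreserving T μ μ)
    (hw : ∀ n, 1 ≤ n → w n ∈ Set.Ioc (0 : ℝ) 1) (hG : Tendsto (partialSum w) atTop atTop)
    (b : ℕ → ℕ) {η : ℝ} (hη : 0 < η) (hb0 : ∀ᶠ n in atTop, 0 < b n)
    (hb : ∀ᶠ n in atTop,
      (1 + 1 / Real.log (Real.log (partialSum w n)) ^ (1 - η)) * b n ≤ b (n + 1))
    {S : ℕ → X → X} (hSm : ∀ n, 1 ≤ n → MeasurePreserving (S n) μ μ)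
    (hS : ∀ᶠ n in atTop, S n = T^[b n]) : SweepsOut μ w S := by
  have hL : ∀ᶠ n in atTop, 1 ≤ Real.log (Real.log (partialSum w n)) :=
    (Real.tendsto_log_atTop.comp (Real.tendsto_log_atTop.comp hG)).eventually_ge_atTop 1
  -- Shrinking `η` below `1` only weakens the growth condition once the iterated logarithm is at
  -- least `1`.
  refine sweepsOut_of_absorbing_sets hw hG hSm fun δ hδ M =>
    exists_absorbing_set hT hap hw hG b (η := min η (1 / 2)) (lt_min hη (by norm_num))
      (lt_of_le_of_lt (min_le_right _ _) (by norm_num)) hb0 ?_ hS hδ M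
  filter_upwards [hb, hL] with n hn hLn
  refine le_trans ?_ hn
  have h1 : 0 < Real.log (Real.log (partialSum w n)) ^ (1 - η) := by positivity
  have h2 : Real.log (Real.log (partialSum w n)) ^ (1 - η) ≤
      Real.log (Real.log (partialSum w n)) ^ (1 - min η (1 / 2)) :=
    Real.rpow_le_rpow_of_exponent_le hLn (by linarith [min_le_left η (1 / 2)])
  gcongr

/-! ### Signs of the exponents and invertible maps -/

/-- The same `B` serves, since pulling back by `T^k` turns its symmetric difference for the inverse
into the one for `T`. -/
theorem Aperiodic.symm {X : Type*} [MeasurableSpace X] {μ : Measure X} {T : X ≃ᵐ X}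
    (hap : Aperiodic μ T) (hT : MeasurePreserving T μ μ) : Aperiodic μ T.symm := by
  intro k hk A hA hpos
  obtain ⟨B, hBA, hB, hBpos⟩ := hap k hk A hA hpos
  refine ⟨B, hBA, hB, ?_⟩
  have hTk := hT.iterate k
  have hTs : Measurable (T.symm)^[k] := T.symm.measurable.iterate k
  rw [← hTk.measure_preimage (hB.symmDiff (hTs hB)).nullMeasurableSet]
  have hinv : (⇑T)^[k] ⁻¹' ((⇑T.symm)^[k] ⁻¹' B) = B := by
    rw [← Set.preimage_comp,
      (Function.LeftInverse.iterate T.symm_apply_apply k).comp_eq_id, Set.preimage_id]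
  have : (⇑T)^[k] ⁻¹' (symmDiff B ((⇑T.symm)^[k] ⁻¹' B)) = symmDiff B ((⇑T)^[k] ⁻¹' B) := by
    rw [Set.preimage_symmDiff, hinv, symmDiff_comm]
  rwa [this]

theorem coe_toEquiv_zpow_natCast {X : Type*} [MeasurableSpace X] (T : X ≃ᵐ X) (m : ℕ) :
    (fun x => ((T.toEquiv : Equiv.Perm X) ^ (m : ℤ)) x) = T^[m] := by
  rw [zpow_natCast]
  exact (Equiv.Perm.iterate_eq_pow (T.toEquiv : Equiv.Perm X) m).symm

theorem coe_toEquiv_zpow_neg_natCast {X : Type*} [MeasurableSpace X] (T : X ≃ᵐ X) (m : ℕ) :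
    (fun x => ((T.toEquiv : Equiv.Perm X) ^ (-(m : ℤ))) x) = T.symm^[m] := by
  rw [← inv_zpow', zpow_natCast]
  exact (Equiv.Perm.iterate_eq_pow (T.toEquiv : Equiv.Perm X)⁻¹ m).symm

theorem measurePreserving_zpow {X : Type*} [MeasurableSpace X] {μ : Measure X} {T : X ≃ᵐ X}
    (hT : MeasurePreserving T μ μ) (m : ℤ) :
    MeasurePreserving (fun x => ((T.toEquiv : Equiv.Perm X) ^ m) x) μ μ := by
  obtain ⟨k, rfl | rfl⟩ := m.eq_nat_or_neg
  · rw [coe_toEquiv_zpow_natCast]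
    exact hT.iterate k
  · rw [coe_toEquiv_zpow_neg_natCast]
    exact (hT.symm T).iterate k

/-- A ratio bounded below by a number greater than one forces an eventually constant sign. -/
theorem eventually_pos_or_eventually_neg {a : ℕ → ℤ}
    (h : ∀ᶠ n in atTop, 0 < (a (n + 1) : ℝ) / a n) :
    (∀ᶠ n in atTop, 0 < a n) ∨ ∀ᶠ n in atTop, a n < 0 := by
  obtain ⟨n₀, hn₀⟩ := eventually_atTop.1 h
  have hstep : ∀ n ≥ n₀, (0 < a n ∧ 0 < a (n + 1)) ∨ (a n < 0 ∧ a (n + 1) < 0) := by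
    intro n hn
    rcases div_pos_iff.1 (hn₀ n hn) with ⟨h1, h2⟩ | ⟨h1, h2⟩
    · exact Or.inl ⟨by exact_mod_cast h2, by exact_mod_cast h1⟩
    · exact Or.inr ⟨by exact_mod_cast h2, by exact_mod_cast h1⟩
  rcases hstep n₀ le_rfl with ⟨h0, -⟩ | ⟨h0, -⟩
  · left
    filter_upwards [eventually_ge_atTop n₀] with n hn
    induction n, hn using Nat.le_induction with
    | base => exact h0
    | succ n hn ih => rcases hstep n hn with h | h <;> omega
  · right
    filter_upwards [eventually_ge_atTop n₀] with n hn
    induction n, hn using Nat.le_induction with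
    | base => exact h0
    | succ n hn ih => rcases hstep n hn with h | h <;> omega

end Sweeping

end WeightedSweeping

theorem theorem4 (w : ℕ → ℝ) (hw : ∀ n : ℕ, 1 ≤ n → w n ∈ Set.Ioc (0 : ℝ) 1)
    (hG : Tendsto (WeightedSweeping.partialSum w) atTop atTop)
    (a : ℕ → ℤ) (η : ℝ) (hη : 0 < η)
    (ha : ∀ᶠ n : ℕ in atTop,
      (a (n + 1) : ℝ) / (a n : ℝ) ≥
        1 + 1 / (Real.log (Real.log (WeightedSweeping.partialSum w n))) ^ (1 - η)) :
    WeightedSweeping.StrongSweepingOut.{u} w a := by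
  have hL : ∀ᶠ n in atTop, 1 ≤ Real.log (Real.log (WeightedSweeping.partialSum w n)) :=
    (Real.tendsto_log_atTop.comp (Real.tendsto_log_atTop.comp hG)).eventually_ge_atTop 1
  have hratio : ∀ᶠ n in atTop, 0 < (a (n + 1) : ℝ) / a n := by
    filter_upwards [ha, hL] with n hn hLn
    refine lt_of_lt_of_le ?_ hn
    positivity
  have hpos : (∀ᶠ n in atTop, 0 < a n) →
      (∀ᶠ n in atTop, 0 < (a n).toNat) ∧ ∀ᶠ n in atTop,
        (1 + 1 / Real.log (Real.log (WeightedSweeping.partialSum w n)) ^ (1 - η)) *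
          ((a n).toNat : ℕ) ≤ ((a (n + 1)).toNat : ℕ) := by
    intro h
    refine ⟨h.mono fun n hn => by omega, ?_⟩
    filter_upwards [ha, h, (tendsto_add_atTop_nat 1).eventually h] with n h1 h2 h3
    have e : ∀ m : ℤ, 0 < m → ((m.toNat : ℕ) : ℝ) = m := fun m hm => by
      exact_mod_cast Int.toNat_of_nonneg hm.le
    rw [e _ h2, e _ h3]
    exact (le_div_iff₀ (by exact_mod_cast h2)).1 h1
  intro X _ μ _
  constructor
  · intro ha0 T hT hap
    rcases WeightedSweeping.eventually_pos_or_eventually_neg hratio with h | h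
    · obtain ⟨h1, h2⟩ := hpos h
      exact hap.sweepsOut_of_growth hT hw hG _ hη h1 h2 (fun n _ => hT.iterate _)
        (Eventually.of_forall fun n => rfl)
    · obtain ⟨n, h1, h2⟩ := (h.and (eventually_ge_atTop 1)).exists
      exact absurd (ha0 n h2) (by omega)
  · intro T hT hap
    rcases WeightedSweeping.eventually_pos_or_eventually_neg hratio with h | h
    · obtain ⟨h1, h2⟩ := hpos h
      refine hap.sweepsOut_of_growth hT hw hG _ hη h1 h2
        (fun n _ => WeightedSweeping.measurePreserving_zpow hT _) ?_
      filter_upwards [h] with n hn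
      rw [← WeightedSweeping.coe_toEquiv_zpow_natCast, Int.toNat_of_nonneg hn.le]
    -- For negative exponents the powers are those of the inverse along `-a n`, whose ratios are the
    -- same.
    · refine (hap.symm hT).sweepsOut_of_growth (hT.symm T) hw hG (fun n => (-a n).toNat) hη
        (h.mono fun n hn => by omega) ?_
        (fun n _ => WeightedSweeping.measurePreserving_zpow hT _) ?_
      · filter_upwards [ha, h, (tendsto_add_atTop_nat 1).eventually h] with n h1 h2 h3
        have e : ∀ m : ℤ, m < 0 → (((-m).toNat : ℕ) : ℝ) = -m := fun m hm => by
          exact_mod_cast Int.toNat_of_nonneg (by omega : 0 ≤ -m)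
        rw [e _ h2, e _ h3]
        have h4 : (0 : ℝ) < -a n := by
          rw [neg_pos]; exact_mod_cast h2
        rw [← neg_div_neg_eq] at h1
        exact (le_div_iff₀ h4).1 h1
      · filter_upwards [h] with n hn
        rw [← WeightedSweeping.coe_toEquiv_zpow_neg_natCast, Int.toNat_of_nonneg (by omega),
          neg_neg]
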